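/- Let $q\in(0,1]$ and let $(R(SU_q(2)),d)$ be the fusion algebra of the compact quantum group $SU_q(2)$ with its quantum dimension function: $R(SU_q(2))=\mathbb{Z}[I]$ has irreducible objects $I=\{0,1,2,\dots\}$ (with unit $0$, fundamental representation $1$ and trivial involution), multiplication given by the fusion rules $m\otimes n=|m-n|\oplus(|m-n|+2)\oplus\cdots\oplus(m+n)$, and dimension function $d$, the ring homomorphism $R(SU_q(2))\to\mathbb{R}$ determined by $d(1)=q+q^{-1}$. For $\alpha,x\in I$ let $\operatorname{supp}(\alpha x)\subseteq I$ be the set of irreducible objects occurring in $\alpha\otimes x$, and for $B\subseteq I$ finite put $|B|=\sum_{\alpha\in B}d(\alpha)^2$. For finite $X,A\subseteq I$ let $$\partial^{\mathrm{inn}}_X(A)=\{\alpha\in A : \exists x\in X,\ \operatorname{supp}(\alpha x)\nsubseteq A\},\qquad \partial_X(A)=\partial_X^{\mathrm{inn}}(A)\cup\{\alpha\in A^c : \exists x\in X,\ \operatorname{supp}(\alpha x)\nsubseteq A^c\}.$$ A finite set $X\subseteq I$, closed under the involution, is generating if every $\alpha\in I$ occurs in some product $x_1\cdots x_n$ with $n\ge1$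 and $x_1,\dots,x_n\in X$. Put $$\text{Føl}^{\mathrm{inn}}_X=\inf_A\frac{|\partial_X^{\mathrm{inn}}(A)|}{|A|},\qquad \text{Føl}_X=\inf_A\frac{|\partial_X(A)|}{|A|},$$ the infima being over the non-empty finite subsets $A\subseteq I$, and let the uniform inner Følner constant $\text{Føl}^{\mathrm{inn}}(R(SU_q(2)))$ and the uniform Følner constant $\text{Føl}(R(SU_q(2)))$ be the infima of $\text{Føl}^{\mathrm{inn}}_X$ and of $\text{Føl}_X$, respectively, over all finite generating sets $X$. Then $$\text{Føl}^{\mathrm{inn}}(R(SU_q(2)))=1-q^2,\qquad \text{Føl}(R(SU_q(2)))=q^{-2}-q^2 .$$ Moreover $\{1\}$ is a generating set and both infima over $X$ are attained at $X=\{1\}$. -/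

import Mathlib

/-- A fusion algebra `(R, d)` with set of irreducible objects `I`: a unital ring structure on the
free abelian group `ℤ[I] = I →₀ ℤ` whose unit is the basis element `e`, with non-negative structure
constants, an involution of `I` whose linear extension is antimultiplicative, Frobenius reciprocity,
and a dimension function. -/
structure FusionAlgebra (I : Type*) where
  /-- the distinguished irreducible object -/
  e : I
  /-- the involution on irreducible objects -/
  conj : I → I
  /-- the (bilinear) multiplication of `ℤ[I]` -/
  mul : (I →₀ ℤ) →ₗ[ℤ] (I →₀ ℤ) →ₗ[ℤ] (I →₀ ℤ)
  /-- the dimension function -/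
  d : (I →₀ ℤ) →ₗ[ℤ] ℝ
  mul_assoc : ∀ a b c, mul (mul a b) c = mul a (mul b c)
  one_mul : ∀ a, mul (Finsupp.single e 1) a = a
  mul_one : ∀ a, mul a (Finsupp.single e 1) = a
  coeff_nonneg : ∀ ξ η α, 0 ≤ mul (Finsupp.single ξ 1) (Finsupp.single η 1) α
  conj_conj : ∀ α, conj (conj α) = α
  conj_mul : ∀ a b, Finsupp.mapDomain conj (mul a b) =
    mul (Finsupp.mapDomain conj b) (Finsupp.mapDomain conj a)
  frobenius_left : ∀ ξ η α, mul (Finsupp.single ξ 1) (Finsupp.single η 1) α =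
    mul (Finsupp.single α 1) (Finsupp.single (conj η) 1) ξ
  frobenius_right : ∀ ξ η α, mul (Finsupp.single ξ 1) (Finsupp.single η 1) α =
    mul (Finsupp.single (conj ξ) 1) (Finsupp.single α 1) η
  d_mul : ∀ a b, d (mul a b) = d a * d b
  d_conj : ∀ α, d (Finsupp.single (conj α) 1) = d (Finsupp.single α 1)
  one_le_d : ∀ α, 1 ≤ d (Finsupp.single α 1)

namespace FusionAlgebra

variable {I : Type*} (F : FusionAlgebra I)

/-- The set of irreducible objects contained in the product `α x`. -/
def suppMul (α x : I) : Set I :=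
  {β | F.mul (Finsupp.single α 1) (Finsupp.single x 1) β ≠ 0}

/-- The product `x₁ ⋯ xₙ` in `ℤ[I]` of a word of irreducible objects. -/
noncomputable def wordProd : List I → (I →₀ ℤ)
  | [] => Finsupp.single F.e 1
  | x :: l => F.mul (Finsupp.single x 1) (wordProd l)

/-- A finite set `X` generates the fusion algebra if it is symmetric and each irreducible object is
contained in some product `x₁ ⋯ xₙ`, `n ≥ 1`, of elements of `X`. -/
def Generates (X : Finset I) : Prop :=
  (∀ x ∈ X, F.conj x ∈ X) ∧
    ∀ α : I, ∃ l : List I, l ≠ [] ∧ (∀ x ∈ l, x ∈ X) ∧ F.wordProd l α ≠ 0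

/-- The inner boundary of `A` with respect to `X`. -/
def innerBoundary (X A : Finset I) : Set I :=
  {α | α ∈ A ∧ ∃ x ∈ X, ¬ F.suppMul α x ⊆ (A : Set I)}

/-- The boundary of `A` with respect to `X`. -/
def boundary (X A : Finset I) : Set I :=
  {α | α ∈ A ∧ ∃ x ∈ X, ¬ F.suppMul α x ⊆ (A : Set I)} ∪
    {α | α ∉ A ∧ ∃ x ∈ X, ¬ F.suppMul α x ⊆ (A : Set I)ᶜ}

theorem innerBoundary_finite (X A : Finset I) : (F.innerBoundary X A).Finite :=
  A.finite_toSet.subset fun _ h => h.1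

/-- Boundaries of finite sets are finite, so that their size below is a finite sum. -/
theorem boundary_finite (X A : Finset I) : (F.boundary X A).Finite := by
  classical
  refine (F.innerBoundary_finite X A).union ?_
  refine (((X ×ˢ A).biUnion fun p =>
    (F.mul (Finsupp.single p.2 1) (Finsupp.single (F.conj p.1) 1)).support).finite_toSet).subset ?_
  rintro α ⟨-, x, hx, h⟩
  obtain ⟨β, hβ, hβA⟩ := Set.not_subset.1 h
  have hβA : β ∈ A := by simpa using hβA
  simp only [Finset.coe_biUnion, Set.mem_iUnion]
  refine ⟨(x, β), by simp [hx, hβA], ?_⟩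
  simp only [Finset.mem_coe, Finsupp.mem_support_iff]
  rw [← F.frobenius_left]
  exact hβ

/-- The size `|B| = ∑_{α ∈ B} d(α)²` of a (finite) set of irreducible objects. -/
noncomputable def size (B : Set I) : ℝ :=
  ∑ᶠ α ∈ B, F.d (Finsupp.single α 1) ^ 2

/-- The Følner constant with respect to `X`; the infimum is over non-empty finite sets. -/
noncomputable def folner (X : Finset I) : ℝ :=
  ⨅ A : {A : Finset I // A.Nonempty}, F.size (F.boundary X A.1) / F.size (A.1 : Set I)

/-- The inner Følner constant with respect to `X`. -/
noncomputable def innerFolner (X : Finset I) : ℝ :=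
  ⨅ A : {A : Finset I // A.Nonempty}, F.size (F.innerBoundary X A.1) / F.size (A.1 : Set I)

/-- The uniform Følner constant; the infimum is over all finite generating sets. -/
noncomputable def uniformFolner : ℝ :=
  ⨅ X : {X : Finset I // F.Generates X}, F.folner X.1

/-- The uniform inner Følner constant. -/
noncomputable def uniformInnerFolner : ℝ :=
  ⨅ X : {X : Finset I // F.Generates X}, F.innerFolner X.1

end FusionAlgebra

namespace SUq2

/-- The fusion rules `m ⊗ n = |m-n| ⊕ (|m-n|+2) ⊕ ⋯ ⊕ (m+n)`. -/
noncomputable def fusion (m n : ℕ) : ℕ →₀ ℤ :=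
  ∑ j ∈ Finset.range (min m n + 1), Finsupp.single (Nat.dist m n + 2 * j) 1

/-- The multiplication of `ℤ[ℕ]`: the bilinear extension of the fusion rules. -/
noncomputable def mul : (ℕ →₀ ℤ) →ₗ[ℤ] (ℕ →₀ ℤ) →ₗ[ℤ] (ℕ →₀ ℤ) :=
  Finsupp.linearCombination ℤ fun m => Finsupp.linearCombination ℤ fun n => fusion m n

/-- The quantum dimensions of the irreducible representations of `SU_q(2)`: `d(0) = 1`,
`d(1) = q + q⁻¹` and `d(1) d(n+1) = d(n) + d(n+2)`. -/
noncomputable def qdim (q : ℝ) : ℕ → ℝ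
  | 0 => 1
  | 1 => q + q⁻¹
  | n + 2 => (q + q⁻¹) * qdim q (n + 1) - qdim q n

/-- The linear extension of the quantum dimension to `ℤ[ℕ]`. -/
noncomputable def dim (q : ℝ) : (ℕ →₀ ℤ) →ₗ[ℤ] ℝ :=
  Finsupp.linearCombination ℤ (qdim q)

theorem mul_single (m n : ℕ) :
    mul (Finsupp.single m 1) (Finsupp.single n 1) = fusion m n := by
  simp [mul]

theorem dim_single (q : ℝ) (n : ℕ) : dim q (Finsupp.single n 1) = qdim q n := by
  simp [dim]

/-- The structure constants are `0` or `1`. -/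
theorem fusion_apply (m n k : ℕ) : fusion m n k =
    if m ≤ n + k ∧ n ≤ m + k ∧ k ≤ m + n ∧ (m + n + k) % 2 = 0 then 1 else 0 := by
  classical
  rw [fusion, Finsupp.finsetSum_apply]
  simp only [Finsupp.single_apply]
  split_ifs with h
  · rw [Finset.sum_eq_single ((k - Nat.dist m n) / 2)]
    · rw [if_pos]
      unfold Nat.dist
      omega
    · intro j _ hj
      rw [if_neg]
      unfold Nat.dist at *
      omega
    · intro hj
      exfalso
      apply hj
      rw [Finset.mem_range]
      unfold Nat.dist
      omega
  · apply Finset.sum_eq_zero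
    intro j hj
    rw [Finset.mem_range] at hj
    rw [if_neg]
    unfold Nat.dist
    omega

theorem fusion_comm (m n : ℕ) : fusion m n = fusion n m := by
  ext k
  simp only [fusion_apply]
  congr 1
  apply propext
  omega

theorem fusion_zero (n : ℕ) : fusion 0 n = Finsupp.single n 1 := by
  simp [fusion, Nat.dist]

theorem fusion_one_succ (n : ℕ) :
    fusion 1 (n + 1) = Finsupp.single n 1 + Finsupp.single (n + 2) 1 := by
  simp [fusion, Nat.dist, Finset.sum_range_succ]

/-- Two linear maps that agree on irreducible objects are equal. -/
theorem hom_ext {M : Type*} [AddCommGroup M] {f g : (ℕ →₀ ℤ) →ₗ[ℤ] M}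
    (h : ∀ n, f (Finsupp.single n 1) = g (Finsupp.single n 1)) : f = g := by
  refine Finsupp.lhom_ext' fun n => LinearMap.ext_ring ?_
  simpa using h n

theorem mul_comm' (a b : ℕ →₀ ℤ) : mul a b = mul b a := by
  have : mul = mul.flip :=
    hom_ext fun m => hom_ext fun n => by
      rw [LinearMap.flip_apply, mul_single, mul_single, fusion_comm]
  exact congrArg (fun f => f a b) this

theorem one_mul' (a : ℕ →₀ ℤ) : mul (Finsupp.single 0 1) a = a := by
  have : mul (Finsupp.single 0 1) = LinearMap.id :=
    hom_ext fun n => by rw [mul_single, fusion_zero, LinearMap.id_apply]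
  rw [this, LinearMap.id_apply]

theorem mul_one_apply_zero (x : ℕ →₀ ℤ) : mul (Finsupp.single 1 1) x 0 = x 1 := by
  have : (Finsupp.lapply 0 : (ℕ →₀ ℤ) →ₗ[ℤ] ℤ) ∘ₗ mul (Finsupp.single 1 1) = Finsupp.lapply 1 :=
    hom_ext fun n => by
      simp only [LinearMap.comp_apply, Finsupp.lapply_apply, mul_single, fusion_apply,
        Finsupp.single_apply]
      split_ifs <;> first | rfl | omega
  exact congrArg (fun f => f x) this

theorem mul_one_apply_succ (x : ℕ →₀ ℤ) (j : ℕ) :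
    mul (Finsupp.single 1 1) x (j + 1) = x j + x (j + 2) := by
  have : (Finsupp.lapply (j + 1) : (ℕ →₀ ℤ) →ₗ[ℤ] ℤ) ∘ₗ mul (Finsupp.single 1 1) =
      Finsupp.lapply j + Finsupp.lapply (j + 2) :=
    hom_ext fun n => by
      simp only [LinearMap.comp_apply, LinearMap.add_apply, Finsupp.lapply_apply, mul_single,
        fusion_apply, Finsupp.single_apply]
      split_ifs <;> first | rfl | omega
  exact congrArg (fun f => f x) this

theorem mul_rec (n : ℕ) (b : ℕ →₀ ℤ) : mul (Finsupp.single (n + 2) 1) b =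
    mul (Finsupp.single 1 1) (mul (Finsupp.single (n + 1) 1) b) - mul (Finsupp.single n 1) b := by
  have : mul (Finsupp.single (n + 2) 1) =
      mul (Finsupp.single 1 1) ∘ₗ mul (Finsupp.single (n + 1) 1) - mul (Finsupp.single n 1) := by
    refine hom_ext fun k => ?_
    ext j
    simp only [LinearMap.comp_apply, LinearMap.sub_apply, mul_single, Finsupp.sub_apply]
    cases j with
    | zero =>
      rw [mul_one_apply_zero]
      simp only [fusion_apply]
      split_ifs <;> first | rfl | omega
    | succ j =>
      rw [mul_one_apply_succ]
      simp only [fusion_apply]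
      split_ifs <;> first | rfl | omega
  exact congrArg (fun f => f b) this

theorem left_comm_one_single (n : ℕ) (b : ℕ →₀ ℤ) :
    mul (Finsupp.single 1 1) (mul (Finsupp.single n 1) b) =
      mul (Finsupp.single n 1) (mul (Finsupp.single 1 1) b) := by
  induction n using Nat.twoStepInduction with
  | zero => rw [one_mul', one_mul']
  | one => rfl
  | more n h0 h1 => rw [mul_rec, mul_rec, map_sub, h0, h1]

theorem left_comm_single (m n : ℕ) (b : ℕ →₀ ℤ) :
    mul (Finsupp.single m 1) (mul (Finsupp.single n 1) b) =
      mul (Finsupp.single n 1) (mul (Finsupp.single m 1) b) := by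
  induction m using Nat.twoStepInduction with
  | zero => rw [one_mul', one_mul']
  | one => exact left_comm_one_single n b
  | more m h0 h1 => rw [mul_rec, mul_rec, h0, h1, left_comm_one_single, map_sub]

theorem left_comm' (a b c : ℕ →₀ ℤ) : mul a (mul b c) = mul b (mul a c) := by
  induction a using Finsupp.induction_linear with
  | zero => simp
  | add a a' h h' => simp only [map_add, LinearMap.add_apply, h, h']
  | single m x =>
    induction b using Finsupp.induction_linear with
    | zero => simp
    | add b b' h h' => simp only [map_add, LinearMap.add_apply, h, h']
    | single n y =>
      rw [← mul_one x, ← mul_one y, ← smul_eq_mul, ← smul_eq_mul, ← Finsupp.smul_single,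
        ← Finsupp.smul_single]
      simp only [map_smul, LinearMap.smul_apply]
      rw [left_comm_single, smul_comm]

theorem mul_assoc' (a b c : ℕ →₀ ℤ) : mul (mul a b) c = mul a (mul b c) := by
  rw [mul_comm', left_comm', mul_comm' c b]

theorem dim_mul_one (b : ℕ →₀ ℤ) (q : ℝ) :
    dim q (mul (Finsupp.single 1 1) b) = (q + q⁻¹) * dim q b := by
  have : dim q ∘ₗ mul (Finsupp.single 1 1) = (q + q⁻¹) • dim q := by
    refine hom_ext fun n => ?_
    rw [LinearMap.comp_apply, LinearMap.smul_apply, mul_single, dim_single]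
    cases n with
    | zero => rw [fusion_comm, fusion_zero, dim_single]; simp [qdim]
    | succ n => rw [fusion_one_succ, map_add, dim_single, dim_single]; simp [qdim]
  exact congrArg (fun f => f b) this

theorem dim_mul_single (q : ℝ) (m : ℕ) (b : ℕ →₀ ℤ) :
    dim q (mul (Finsupp.single m 1) b) = qdim q m * dim q b := by
  induction m using Nat.twoStepInduction with
  | zero => simp [one_mul', qdim]
  | one => simp [dim_mul_one, qdim]
  | more m h0 h1 => rw [mul_rec, map_sub, dim_mul_one, h0, h1, qdim]; ring

theorem dim_mul (q : ℝ) (a b : ℕ →₀ ℤ) : dim q (mul a b) = dim q a * dim q b := by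
  induction a using Finsupp.induction_linear with
  | zero => simp
  | add a a' h h' => simp only [map_add, LinearMap.add_apply, h, h', add_mul]
  | single m x =>
    rw [← mul_one x, ← smul_eq_mul, ← Finsupp.smul_single]
    simp only [map_smul, LinearMap.smul_apply, dim_mul_single, dim_single, smul_mul_assoc]

theorem one_le_qdim (q : ℝ) (hq : 0 < q) (n : ℕ) : 1 ≤ qdim q n := by
  have h2 : 2 ≤ q + q⁻¹ := by
    have h : q * q⁻¹ = 1 := mul_inv_cancel₀ hq.ne'
    nlinarith [sq_nonneg (q - q⁻¹), inv_pos.2 hq]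
  have key : ∀ n, 1 ≤ qdim q n ∧ qdim q n ≤ qdim q (n + 1) := by
    intro n
    induction n with
    | zero => simp only [qdim]; constructor <;> linarith
    | succ n ih =>
      refine ⟨ih.1.trans ih.2, ?_⟩
      rw [qdim]
      nlinarith [ih.1, ih.2]
  exact (key n).1

end SUq2

/-- The fusion algebra `R(SU_q(2))`, for `q > 0`: irreducible objects indexed by `ℕ`, where `1` is
the fundamental representation, the trivial involution (irreducible representations are
self-conjugate), the fusion rules of `SU(2)` and the quantum dimension. -/
noncomputable def fusionAlgebraSUq2 (q : ℝ) (hq : 0 < q) : FusionAlgebra ℕ where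
  e := 0
  conj := id
  mul := SUq2.mul
  d := SUq2.dim q
  mul_assoc := SUq2.mul_assoc'
  one_mul := SUq2.one_mul'
  mul_one a := by rw [SUq2.mul_comm', SUq2.one_mul']
  coeff_nonneg m n k := by
    rw [SUq2.mul_single, SUq2.fusion_apply]
    split_ifs <;> norm_num
  conj_conj _ := rfl
  conj_mul a b := by
    rw [Finsupp.mapDomain_id, Finsupp.mapDomain_id, Finsupp.mapDomain_id, SUq2.mul_comm']
  frobenius_left m n k := by
    simp only [SUq2.mul_single, SUq2.fusion_apply, id]
    split_ifs <;> first | rfl | omega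
  frobenius_right m n k := by
    simp only [SUq2.mul_single, SUq2.fusion_apply, id]
    split_ifs <;> first | rfl | omega
  d_mul := SUq2.dim_mul q
  d_conj _ := rfl
  one_le_d n := by
    rw [SUq2.dim_single]
    exact SUq2.one_le_qdim q hq n

namespace FusionAlgebra

variable {I : Type*} (F : FusionAlgebra I)

/-! Lower bounds: a generating set `X` contains some `k > 0`, and the shift `α ↦ α + k` is
injective, picks a constituent of `α ⊗ k`, and multiplies `d²` by at least `q⁻²`. Hence the points
of `A` that stay in `A` have total size at most `q²|A|`. The remaining ones, of size at least `(1 -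
q²)|A|`, lie in the inner boundary (`le_size_innerBoundary`). Their shifts lie in the outer boundary
by Frobenius reciprocity and are larger by a factor `q⁻²`, so the whole boundary has size at least
`(1 + q⁻²)(1 - q²)|A| = (q⁻² - q²)|A|` (`le_size_boundary`). Upper bounds: for `X = {1}` and `A =
{0, …, n}` the boundary is contained in `{n, n + 1}` and its inner part in `{n}`. By
`qdim_sq_le_sum`, `d(n)²` is at most `(1 - q²)|A|` up to a quadratic error, whereas `|A|` grows at
least cubically, so the error vanishes in the limit, including at `q = 1`. -/

theorem size_coe (A : Finset I) :
    F.size (A : Set I) = ∑ α ∈ A, F.d (Finsupp.single α 1) ^ 2 :=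
  finsum_mem_coe_finset _ _

theorem size_mono_of_finite {B C : Set I} (hC : C.Finite) (h : B ⊆ C) : F.size B ≤ F.size C := by
  lift C to Finset I using hC
  lift B to Finset I using C.finite_toSet.subset h
  rw [size_coe, size_coe]
  exact Finset.sum_le_sum_of_subset_of_nonneg (by exact_mod_cast h) fun _ _ _ => sq_nonneg _

theorem size_pos {A : Finset I} (hA : A.Nonempty) : 0 < F.size (A : Set I) := by
  rw [size_coe]
  exact Finset.sum_pos (fun α _ => by have := F.one_le_d α; positivity) hA

theorem size_nonneg (B : Set I) : 0 ≤ F.size B :=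
  finsum_mem_induction (0 ≤ ·) le_rfl (fun _ _ => add_nonneg) fun _ _ => sq_nonneg _

/-- Frobenius reciprocity: if `β` occurs in `α x`, then `α` occurs in `β x̄`. -/
theorem mem_suppMul_conj {α β x : I} (h : β ∈ F.suppMul α x) : α ∈ F.suppMul β (F.conj x) := by
  simpa only [suppMul, Set.mem_ofPred_eq, ← F.frobenius_left] using h

/-! ### Boundary estimates from an expanding injective shift -/

section Shift

variable {X : Finset I} {x : I} {f : I → I} {t : ℝ}

theorem mul_size_le_size_map (hf : Function.Injective f)
    (hd : ∀ α, t * F.d (Finsupp.single α 1) ^ 2 ≤ F.d (Finsupp.single (f α) 1) ^ 2)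
    (B : Finset I) : t * F.size (B : Set I) ≤ F.size (B.map ⟨f, hf⟩ : Set I) := by
  rw [size_coe, size_coe, Finset.sum_map, Finset.mul_sum]
  exact Finset.sum_le_sum fun α _ => hd α

/-- If an injective self-map `f` of the irreducible objects multiplies squared dimensions by at
least `t`, then each finite `A` has a large subset which `f` maps out of `A`. -/
theorem le_size_filter_notMem [DecidableEq I] (hf : Function.Injective f) (ht : 0 < t)
    (hd : ∀ α, t * F.d (Finsupp.single α 1) ^ 2 ≤ F.d (Finsupp.single (f α) 1) ^ 2)
    (A : Finset I) :
    (1 - t⁻¹) * F.size (A : Set I) ≤ F.size (A.filter (f · ∉ A) : Set I) := by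
  -- The points that stay in `A` are carried injectively into `A`, their size growing by at least
  -- `t`.
  have hT : t * F.size (A.filter (f · ∈ A) : Set I) ≤ F.size (A : Set I) := by
    refine (F.mul_size_le_size_map hf hd _).trans (F.size_mono_of_finite A.finite_toSet ?_)
    intro β hβ
    obtain ⟨α, hα, rfl⟩ := Finset.mem_map.1 (Finset.mem_coe.1 hβ)
    exact (Finset.mem_filter.1 hα).2
  have hsplit : F.size (A.filter (f · ∈ A) : Set I) + F.size (A.filter (f · ∉ A) : Set I) =
      F.size (A : Set I) := by
    simp only [size_coe]
    exact Finset.sum_filter_add_sum_filter_not A _ _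
  rw [← le_inv_mul_iff₀ ht] at hT
  linarith

theorem le_size_innerBoundary (hx : x ∈ X) (hf : Function.Injective f)
    (hsupp : ∀ α, f α ∈ F.suppMul α x) (ht : 0 < t)
    (hd : ∀ α, t * F.d (Finsupp.single α 1) ^ 2 ≤ F.d (Finsupp.single (f α) 1) ^ 2)
    (A : Finset I) :
    (1 - t⁻¹) * F.size (A : Set I) ≤ F.size (F.innerBoundary X A) := by
  classical
  refine (F.le_size_filter_notMem hf ht hd A).trans
    (F.size_mono_of_finite (F.innerBoundary_finite X A) fun α hα => ?_)
  obtain ⟨hα, hfα⟩ := Finset.mem_filter.1 (Finset.mem_coe.1 hα)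
  exact ⟨hα, x, hx, fun h => hfα (h (hsupp α))⟩

/-- The points `T` of `A` that leave `A` and their images `f(T)` are disjoint, and `|f(T)| ≥ t|T|`;
this yields the factor `1 + t`. Symmetry of `X` puts `f(T)` in the boundary, since `f α` reaches `α`
through `F.conj x`. -/
theorem le_size_boundary (hX : F.Generates X) (hx : x ∈ X) (hf : Function.Injective f)
    (hsupp : ∀ α, f α ∈ F.suppMul α x) (ht : 0 < t)
    (hd : ∀ α, t * F.d (Finsupp.single α 1) ^ 2 ≤ F.d (Finsupp.single (f α) 1) ^ 2)
    (A : Finset I) :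
    (1 + t) * (1 - t⁻¹) * F.size (A : Set I) ≤ F.size (F.boundary X A) := by
  classical
  set T := A.filter (f · ∉ A) with hT
  have hdisj : Disjoint T (T.map ⟨f, hf⟩) := by
    rw [Finset.disjoint_left]
    intro β hβ hβ'
    obtain ⟨α, hα, rfl⟩ := Finset.mem_map.1 hβ'
    exact (Finset.mem_filter.1 hα).2 (Finset.mem_filter.1 hβ).1
  have hsub : ((T ∪ T.map ⟨f, hf⟩ : Finset I) : Set I) ⊆ F.boundary X A := by
    intro β hβ
    rcases Finset.mem_union.1 (Finset.mem_coe.1 hβ) with hβ | hβ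
    · obtain ⟨hα, hfα⟩ := Finset.mem_filter.1 hβ
      exact Or.inl ⟨hα, x, hx, fun h => hfα (h (hsupp β))⟩
    · obtain ⟨α, hα, rfl⟩ := Finset.mem_map.1 hβ
      obtain ⟨hα, hfα⟩ := Finset.mem_filter.1 hα
      exact Or.inr ⟨hfα, F.conj x, hX.1 x hx, fun h => h (F.mem_suppMul_conj (hsupp α)) hα⟩
  have hsum : F.size ((T ∪ T.map ⟨f, hf⟩ : Finset I) : Set I) =
      F.size (T : Set I) + F.size (T.map ⟨f, hf⟩ : Set I) := by
    simp only [size_coe]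
    exact Finset.sum_union hdisj
  have h1 := F.le_size_filter_notMem hf ht hd A
  have h2 := F.mul_size_le_size_map hf hd T
  have h3 := F.size_mono_of_finite (F.boundary_finite X A) hsub
  have h4 := mul_le_mul_of_nonneg_left h1 (by positivity : 0 ≤ 1 + t)
  rw [← hT] at h4
  linarith

end Shift

theorem innerFolner_le (X : Finset I) {A : Finset I} (hA : A.Nonempty) :
    F.innerFolner X ≤ F.size (F.innerBoundary X A) / F.size (A : Set I) :=
  ciInf_le (f := fun A : {A : Finset I // A.Nonempty} =>
    F.size (F.innerBoundary X A.1) / F.size (A.1 : Set I))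
    ⟨0, by rintro _ ⟨B, rfl⟩; exact div_nonneg (F.size_nonneg _) (F.size_nonneg _)⟩ ⟨A, hA⟩

theorem folner_le (X : Finset I) {A : Finset I} (hA : A.Nonempty) :
    F.folner X ≤ F.size (F.boundary X A) / F.size (A : Set I) :=
  ciInf_le (f := fun A : {A : Finset I // A.Nonempty} =>
    F.size (F.boundary X A.1) / F.size (A.1 : Set I))
    ⟨0, by rintro _ ⟨B, rfl⟩; exact div_nonneg (F.size_nonneg _) (F.size_nonneg _)⟩ ⟨A, hA⟩

theorem le_innerFolner {X : Finset I} {c : ℝ}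
    (h : ∀ A : Finset I, c * F.size (A : Set I) ≤ F.size (F.innerBoundary X A)) :
    c ≤ F.innerFolner X :=
  -- A real infimum over an empty index type would be `0` by default.
  haveI : Nonempty {A : Finset I // A.Nonempty} := ⟨{F.e}, Finset.singleton_nonempty _⟩
  le_ciInf fun A => (le_div_iff₀ (F.size_pos A.2)).2 (h A.1)

theorem le_folner {X : Finset I} {c : ℝ}
    (h : ∀ A : Finset I, c * F.size (A : Set I) ≤ F.size (F.boundary X A)) :
    c ≤ F.folner X :=
  haveI : Nonempty {A : Finset I // A.Nonempty} := ⟨{F.e}, Finset.singleton_nonempty _⟩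
  le_ciInf fun A => (le_div_iff₀ (F.size_pos A.2)).2 (h A.1)

end FusionAlgebra

namespace SUq2

/-! ### Growth of the quantum dimensions -/

section Dimension

variable {q : ℝ}

/-- This first-order recursion replaces the second-order one and drives the estimates for both
bounds. -/
theorem mul_qdim_succ (hq : q ≠ 0) (n : ℕ) : q * qdim q (n + 1) = qdim q n + q ^ (n + 2) := by
  induction n with
  | zero => simp only [qdim]; field_simp; ring
  | succ n ih =>
    have h : q * q⁻¹ = 1 := mul_inv_cancel₀ hq
    rw [qdim]
    linear_combination q * ih + qdim q (n + 1) * h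

theorem qdim_le_mul_qdim_add (hq0 : 0 < q) (hq1 : q ≤ 1) (n : ℕ) {k : ℕ} (hk : 0 < k) :
    qdim q n ≤ q * qdim q (n + k) := by
  induction k, hk using Nat.le_induction with
  | base => rw [mul_qdim_succ hq0.ne']; linarith [pow_pos hq0 (n + 2)]
  | succ k _ ih =>
    have h := mul_qdim_succ hq0.ne' (n + k)
    have h1 := one_le_qdim q hq0 (n + k)
    rw [← add_assoc]
    nlinarith [pow_pos hq0 (n + k + 2)]

theorem inv_sq_mul_qdim_sq_le (hq0 : 0 < q) (hq1 : q ≤ 1) (n : ℕ) {k : ℕ} (hk : 0 < k) :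
    (q ^ 2)⁻¹ * qdim q n ^ 2 ≤ qdim q (n + k) ^ 2 := by
  rw [inv_mul_le_iff₀ (by positivity), ← mul_pow]
  exact pow_le_pow_left₀ (zero_le_one.trans (one_le_qdim q hq0 n))
    (qdim_le_mul_qdim_add hq0 hq1 n hk) 2

theorem add_one_le_qdim (hq : 0 < q) (n : ℕ) : (n + 1 : ℝ) ≤ qdim q n := by
  have h2 : 2 ≤ q + q⁻¹ := by
    have h : q * q⁻¹ = 1 := mul_inv_cancel₀ hq.ne'
    nlinarith [sq_nonneg (q - q⁻¹), inv_pos.2 hq]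
  have key : ∀ n : ℕ, (n + 1 : ℝ) ≤ qdim q n ∧ qdim q n + 1 ≤ qdim q (n + 1) := by
    intro n
    induction n with
    | zero => simp only [qdim]; constructor <;> norm_num; linarith
    | succ n ih =>
      refine ⟨by push_cast; linarith [ih.1, ih.2], ?_⟩
      rw [qdim]
      nlinarith [ih.2, one_le_qdim q hq (n + 1)]
  exact (key n).1

theorem pow_mul_qdim_le (hq0 : 0 < q) (hq1 : q ≤ 1) (n : ℕ) : q ^ n * qdim q n ≤ n + 1 := by
  induction n with
  | zero => simp [qdim]
  | succ n ih =>
    have h : q ^ (n + 1) * qdim q (n + 1) = q ^ n * qdim q n + q ^ (2 * n + 2) := by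
      linear_combination q ^ n * mul_qdim_succ hq0.ne' n
    have := pow_le_one₀ hq0.le hq1 (n := 2 * n + 2)
    push_cast
    linarith

theorem qdim_succ_sq_le (hq0 : 0 < q) (hq1 : q ≤ 1) (n : ℕ) :
    qdim q (n + 1) ^ 2 ≤ (q ^ 2)⁻¹ * qdim q n ^ 2 + (2 * n + 3) := by
  have h1 : qdim q (n + 1) = q⁻¹ * (qdim q n + q ^ (n + 2)) := by
    rw [← mul_qdim_succ hq0.ne', inv_mul_cancel_left₀ hq0.ne']
  have h2 : qdim q (n + 1) ^ 2 =
      (q ^ 2)⁻¹ * qdim q n ^ 2 + 2 * (q ^ n * qdim q n) + q ^ (2 * n + 2) := by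
    rw [h1]; field_simp; ring
  have := pow_mul_qdim_le hq0 hq1 n
  have := pow_le_one₀ hq0.le hq1 (n := 2 * n + 2)
  linarith

/-- Write `d(n+1)² = (1 - q²)d(n+1)² + q²d(n+1)²`; the last term is at most `d(n)² + 2n + 3`, and
`(n+1)² + (2n+3) = (n+2)²`. -/
theorem qdim_sq_le_sum (hq0 : 0 < q) (hq1 : q ≤ 1) (n : ℕ) :
    qdim q n ^ 2 ≤ (1 - q ^ 2) * ∑ k ∈ Finset.range (n + 1), qdim q k ^ 2 + (n + 1) ^ 2 := by
  induction n with
  | zero =>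
    have := pow_le_one₀ hq0.le hq1 (n := 2)
    rw [zero_add, Finset.sum_range_one, qdim]
    push_cast
    linarith
  | succ n ih =>
    have h := mul_le_mul_of_nonneg_left (qdim_succ_sq_le hq0 hq1 n) (sq_nonneg q)
    rw [mul_add, mul_inv_cancel_left₀ (by positivity)] at h
    have h' : q ^ 2 * (2 * n + 3) ≤ 1 * (2 * (n : ℝ) + 3) := by
      gcongr
      exact pow_le_one₀ hq0.le hq1
    rw [Finset.sum_range_succ]
    push_cast
    linarith

/-- Compare with the sum of `(k + 1)²`, using `d(k) ≥ k + 1`. -/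
theorem cube_le_sum_qdim_sq (hq : 0 < q) (n : ℕ) :
    (n : ℝ) ^ 3 ≤ 3 * ∑ k ∈ Finset.range n, qdim q k ^ 2 := by
  induction n with
  | zero => simp
  | succ n ih =>
    have := pow_le_pow_left₀ (by positivity) (add_one_le_qdim hq n) 2
    rw [Finset.sum_range_succ]
    push_cast
    nlinarith [(n.cast_nonneg : (0 : ℝ) ≤ n)]

end Dimension

/-! ### Generating sets -/

theorem wordProd_replicate_one (q : ℝ) (hq : 0 < q) (n : ℕ) :
    (∀ j, 0 ≤ (fusionAlgebraSUq2 q hq).wordProd (List.replicate n 1) j) ∧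
      0 < (fusionAlgebraSUq2 q hq).wordProd (List.replicate n 1) n := by
  induction n with
  | zero =>
    refine ⟨fun j => ?_, ?_⟩
    · simp only [List.replicate_zero, FusionAlgebra.wordProd, Finsupp.single_apply]
      split_ifs <;> norm_num
    · simp [FusionAlgebra.wordProd, fusionAlgebraSUq2]
  | succ n ih =>
    have h : (fusionAlgebraSUq2 q hq).wordProd (List.replicate (n + 1) 1) =
      mul (Finsupp.single 1 1) ((fusionAlgebraSUq2 q hq).wordProd (List.replicate n 1)) := rfl
    rw [h]
    refine ⟨fun j => ?_, ?_⟩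
    · cases j with
      | zero => rw [mul_one_apply_zero]; exact ih.1 1
      | succ j => rw [mul_one_apply_succ]; exact add_nonneg (ih.1 _) (ih.1 _)
    -- Nonnegativity of all coefficients rules out cancellation.
    · rw [mul_one_apply_succ]; exact add_pos_of_pos_of_nonneg ih.2 (ih.1 _)

theorem generates_one (q : ℝ) (hq : 0 < q) : (fusionAlgebraSUq2 q hq).Generates {1} := by
  refine ⟨fun x hx => hx, fun α => ?_⟩
  cases α with
  | zero =>
    -- The empty word is not allowed, so the unit is found in `1 ⊗ 1`.
    refine ⟨[1, 1], by simp, by simp, ?_⟩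
    have h : (fusionAlgebraSUq2 q hq).wordProd [1, 1] = mul (Finsupp.single 1 1)
      ((fusionAlgebraSUq2 q hq).wordProd (List.replicate 1 1)) := rfl
    rw [h, mul_one_apply_zero]
    exact (wordProd_replicate_one q hq 1).2.ne'
  | succ n =>
    exact ⟨List.replicate (n + 1) 1, by simp, fun x hx => by simp [List.eq_of_mem_replicate hx],
      (wordProd_replicate_one q hq (n + 1)).2.ne'⟩

theorem exists_pos_mem_of_generates {q : ℝ} {hq : 0 < q} {X : Finset ℕ}
    (hX : (fusionAlgebraSUq2 q hq).Generates X) : ∃ k ∈ X, 0 < k := by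
  by_contra! h
  -- Words in the unit alone produce only the unit, so they miss the object `1`.
  obtain ⟨l, -, hl, hne⟩ := hX.2 1
  have key : ∀ l : List ℕ, (∀ x ∈ l, x = 0) →
      (fusionAlgebraSUq2 q hq).wordProd l = Finsupp.single 0 1 := by
    intro l hl
    induction l with
    | nil => rfl
    | cons x l ih =>
      rw [FusionAlgebra.wordProd, ih fun y hy => hl y (List.mem_cons_of_mem _ hy),
        hl x List.mem_cons_self]
      exact (fusionAlgebraSUq2 q hq).one_mul _
  rw [key l fun x hx => Nat.le_zero.1 (h x (hl x hx))] at hne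
  simp at hne

theorem mem_suppMul {q : ℝ} {hq : 0 < q} {m n k : ℕ} :
    k ∈ (fusionAlgebraSUq2 q hq).suppMul m n ↔
      m ≤ n + k ∧ n ≤ m + k ∧ k ≤ m + n ∧ (m + n + k) % 2 = 0 := by
  change mul (Finsupp.single m 1) (Finsupp.single n 1) k ≠ 0 ↔ _
  rw [mul_single, fusion_apply]
  split_ifs with h <;> simp [h]

theorem d_single {q : ℝ} {hq : 0 < q} (n : ℕ) :
    (fusionAlgebraSUq2 q hq).d (Finsupp.single n 1) = qdim q n :=
  dim_single q n

/-! ### Upper bounds from intervals -/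

theorem innerBoundary_range {q : ℝ} {hq : 0 < q} (n : ℕ) :
    (fusionAlgebraSUq2 q hq).innerBoundary {1} (Finset.range (n + 1)) ⊆ ({n} : Finset ℕ) := by
  rintro α ⟨hα, x, hx, h⟩
  obtain rfl := Finset.mem_singleton.1 hx
  obtain ⟨β, hβ, hβA⟩ := Set.not_subset.1 h
  rw [mem_suppMul] at hβ
  simp only [Finset.coe_range, Set.mem_Iio, Finset.mem_range, Finset.coe_singleton,
    Set.mem_singleton_iff] at *
  omega

theorem boundary_range {q : ℝ} {hq : 0 < q} (n : ℕ) :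
    (fusionAlgebraSUq2 q hq).boundary {1} (Finset.range (n + 1)) ⊆ ({n, n + 1} : Finset ℕ) := by
  rintro α (hα | ⟨hα, x, hx, h⟩)
  · have := innerBoundary_range n hα
    simp_all
  · obtain rfl := Finset.mem_singleton.1 hx
    obtain ⟨β, hβ, hβA⟩ := Set.not_subset.1 h
    rw [mem_suppMul] at hβ
    simp only [Finset.coe_range, Set.mem_compl_iff, not_not, Set.mem_Iio, Finset.mem_range,
      Finset.coe_insert, Finset.coe_singleton, Set.mem_insert_iff, Set.mem_singleton_iff] at *
    omega

theorem le_of_forall_le_add_div {a b C : ℝ} (h : ∀ n : ℕ, a ≤ b + C / (n + 1)) : a ≤ b := by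
  refine ge_of_tendsto' (f := fun n : ℕ => b + C / ((n : ℝ) + 1)) (x := Filter.atTop) ?_ h
  simpa [div_eq_mul_inv] using
    (tendsto_one_div_add_atTop_nhds_zero_nat (𝕜 := ℝ)).const_mul C |>.const_add b

/-- The sum is at least `(n + 1)³ / 3`, so the quadratic error contributes at most `3C / (n + 1)`.
-/
theorem le_of_forall_mul_le {q : ℝ} (hq : 0 < q) {a b C : ℝ} (hC : 0 ≤ C)
    (h : ∀ n : ℕ, a ≤ (b * ∑ k ∈ Finset.range (n + 1), qdim q k ^ 2 + C * (n + 1) ^ 2) /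
      ∑ k ∈ Finset.range (n + 1), qdim q k ^ 2) : a ≤ b := by
  refine le_of_forall_le_add_div (C := 3 * C) fun n => (h n).trans ?_
  have hS := cube_le_sum_qdim_sq hq (n + 1)
  push_cast at hS
  set S := ∑ k ∈ Finset.range (n + 1), qdim q k ^ 2
  have hn : (0 : ℝ) < n + 1 := by positivity
  have hpos : 0 < S := by nlinarith [pow_pos hn 3]
  rw [add_div, mul_div_cancel_right₀ _ hpos.ne', add_le_add_iff_left, div_le_div_iff₀ hpos hn]
  nlinarith [mul_le_mul_of_nonneg_left hS hC]

theorem innerFolner_one_le {q : ℝ} (hq0 : 0 < q) (hq1 : q ≤ 1) :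
    (fusionAlgebraSUq2 q hq0).innerFolner {1} ≤ 1 - q ^ 2 := by
  refine le_of_forall_mul_le hq0 zero_le_one fun n => ?_
  refine (FusionAlgebra.innerFolner_le _ _ (Finset.nonempty_range_add_one (n := n))).trans ?_
  rw [FusionAlgebra.size_coe]
  simp only [d_single]
  refine div_le_div_of_nonneg_right ?_ (Finset.sum_nonneg fun _ _ => sq_nonneg _)
  refine (FusionAlgebra.size_mono_of_finite _ (Finset.finite_toSet _)
    (innerBoundary_range n)).trans ?_
  rw [FusionAlgebra.size_coe, Finset.sum_singleton, d_single, one_mul]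
  exact qdim_sq_le_sum hq0 hq1 n

theorem folner_one_le {q : ℝ} (hq0 : 0 < q) (hq1 : q ≤ 1) :
    (fusionAlgebraSUq2 q hq0).folner {1} ≤ (1 + (q ^ 2)⁻¹) * (1 - q ^ 2) := by
  have hi : 0 < (q ^ 2)⁻¹ := by positivity
  -- The first summand of `C` scales the error for `d(n)²`; the `3` absorbs `2n + 3 ≤ 3(n + 1)²`,
  -- the error in passing to `d(n+1)²`.
  refine le_of_forall_mul_le hq0 (C := (1 + (q ^ 2)⁻¹) + 3) (by positivity) fun n => ?_
  refine (FusionAlgebra.folner_le _ _ (Finset.nonempty_range_add_one (n := n))).trans ?_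
  rw [FusionAlgebra.size_coe]
  simp only [d_single]
  refine div_le_div_of_nonneg_right ?_ (Finset.sum_nonneg fun _ _ => sq_nonneg _)
  refine (FusionAlgebra.size_mono_of_finite _ (Finset.finite_toSet _)
    (boundary_range n)).trans ?_
  rw [FusionAlgebra.size_coe, Finset.sum_pair n.succ_ne_self.symm, d_single, d_single]
  have h1 := mul_le_mul_of_nonneg_left (qdim_sq_le_sum hq0 hq1 n)
    (by positivity : 0 ≤ 1 + (q ^ 2)⁻¹)
  have h2 := qdim_succ_sq_le hq0 hq1 n
  nlinarith [(n.cast_nonneg : (0 : ℝ) ≤ n)]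

/-! ### Lower bounds for all generating sets -/

theorem le_innerFolner {q : ℝ} {X : Finset ℕ} (hq0 : 0 < q) (hq1 : q ≤ 1)
    (hX : (fusionAlgebraSUq2 q hq0).Generates X) :
    1 - q ^ 2 ≤ (fusionAlgebraSUq2 q hq0).innerFolner X := by
  obtain ⟨k, hkX, hk⟩ := exists_pos_mem_of_generates hX
  refine FusionAlgebra.le_innerFolner _ fun A => ?_
  -- The shift selects the top constituent `α + k` of `α ⊗ k`, with `t = q⁻²` whatever `k > 0` is.
  have := (fusionAlgebraSUq2 q hq0).le_size_innerBoundary hkX (add_left_injective k)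
    (fun α => mem_suppMul.2 (by omega)) (by positivity : 0 < (q ^ 2)⁻¹)
    (fun α => by simpa only [d_single] using inv_sq_mul_qdim_sq_le hq0 hq1 α hk) A
  rwa [inv_inv] at this

theorem le_folner {q : ℝ} {X : Finset ℕ} (hq0 : 0 < q) (hq1 : q ≤ 1)
    (hX : (fusionAlgebraSUq2 q hq0).Generates X) :
    (1 + (q ^ 2)⁻¹) * (1 - q ^ 2) ≤ (fusionAlgebraSUq2 q hq0).folner X := by
  obtain ⟨k, hkX, hk⟩ := exists_pos_mem_of_generates hX
  refine FusionAlgebra.le_folner _ fun A => ?_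
  have := (fusionAlgebraSUq2 q hq0).le_size_boundary hX hkX (add_left_injective k)
    (fun α => mem_suppMul.2 (by omega)) (by positivity : 0 < (q ^ 2)⁻¹)
    (fun α => by simpa only [d_single] using inv_sq_mul_qdim_sq_le hq0 hq1 α hk) A
  rwa [inv_inv] at this

end SUq2

/-- An infimum over a subtype whose smallest value is attained. -/
theorem ciInf_subtype_eq_of_forall_le {ι : Type*} {p : ι → Prop} {f : ι → ℝ} {i : ι} (hi : p i)
    (h : ∀ j, p j → f i ≤ f j) : ⨅ j : {j // p j}, f j = f i :=
  IsLeast.csInf_eq ⟨⟨⟨i, hi⟩, rfl⟩, by rintro _ ⟨j, rfl⟩; exact h j j.2⟩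

theorem proposition12 (q : ℝ) (hq0 : 0 < q) (hq1 : q ≤ 1) :
    (fusionAlgebraSUq2 q hq0).uniformInnerFolner = 1 - q ^ 2 ∧
    (fusionAlgebraSUq2 q hq0).uniformFolner = q ^ (-2 : ℤ) - q ^ 2 ∧
    (fusionAlgebraSUq2 q hq0).Generates {1} ∧
    (fusionAlgebraSUq2 q hq0).innerFolner {1} = (fusionAlgebraSUq2 q hq0).uniformInnerFolner ∧
    (fusionAlgebraSUq2 q hq0).folner {1} = (fusionAlgebraSUq2 q hq0).uniformFolner := by
  have hgen := SUq2.generates_one q hq0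
  have hinner := (SUq2.innerFolner_one_le hq0 hq1).antisymm (SUq2.le_innerFolner hq0 hq1 hgen)
  have hfol := (SUq2.folner_one_le hq0 hq1).antisymm (SUq2.le_folner hq0 hq1 hgen)
  have huinner : (fusionAlgebraSUq2 q hq0).uniformInnerFolner =
      (fusionAlgebraSUq2 q hq0).innerFolner {1} :=
    ciInf_subtype_eq_of_forall_le hgen fun X hX => hinner.trans_le (SUq2.le_innerFolner hq0 hq1 hX)
  have hufol : (fusionAlgebraSUq2 q hq0).uniformFolner = (fusionAlgebraSUq2 q hq0).folner {1} :=
    ciInf_subtype_eq_of_forall_le hgen fun X hX => hfol.trans_le (SUq2.le_folner hq0 hq1 hX)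
  refine ⟨huinner.trans hinner, (hufol.trans hfol).trans ?_, hgen, huinner.symm, hufol.symm⟩
  rw [zpow_neg]
  norm_cast
  field_simp
  ring
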